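/- **Theorem (Optimal Gaussian Approximation).** Let $\sigma>0$, let $p_d$ be a probability distribution on $\mathbb{R}^d$ that has a density with respect to Lebesgue measure, let $p(\tilde x\mid x)=\mathcal N(x,\sigma^2 I)$ be the noise distribution and let $\tilde p_d(\tilde x)=\int p_d(x)\,p(\tilde x\mid x)\,dx$ be the noised data distribution. Let $p(x\mid\tilde x)\propto p_d(x)\,p(\tilde x\mid x)$ be the true posterior at $\tilde x$, and let $\mu^*(\tilde x)=\langle x\rangle_{p(x\mid\tilde x)}$ be its mean. Consider the joint Kullback–Leibler divergence $$J(q)=\mathrm{KL}\big(p(\tilde x\mid x)\,p_d(x)\,\big\|\,q(x\mid\tilde x)\,\tilde p_d(\tilde x)\big)\in[0,\infty]$$ on the family of all Gaussian conditionals $q(x\mid\tilde x)=\mathcal N(\mu_q(\tilde x),\Sigma_q(\tilde x))$, where $\mu_q(\tilde x)\in\mathbb{R}^d$ and the positive semidefinite matrix $\Sigma_q(\tilde x)\in\mathbb{R}^{d\times d}$ depend measurably on $\tilde x$. Then $\mu^*$ is differentiable on $\mathbb{R}^d$, the matrix $\sigma^2\nabla_{\tilde x}\mu^*(\tilde x)$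 is (symmetric) positive definite for every $\tilde x$, and: 1. the Gaussian conditional $q^*(x\mid\tilde x)=\mathcal N\big(\mu^*(\tilde x),\ \sigma^2\nabla_{\tilde x}\mu^*(\tilde x)\big)$ minimises $J$ over this family; 2. the minimiser is unique whenever the objective is finite: if $q=\mathcal N(\mu_q,\Sigma_q)$ belongs to the family and $J(q)<\infty$, then $q$ minimises $J$ over the family if and only if $$\mu_q(\tilde x)=\langle x\rangle_{p(x\mid\tilde x)}\quad\text{and}\quad \Sigma_q(\tilde x)=\sigma^2\nabla_{\tilde x}\mu^*(\tilde x)\qquad\text{for }\tilde p_d\text{-almost every }\tilde x .$$ -/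

import Mathlib

open MeasureTheory ProbabilityTheory
open scoped ENNReal

namespace GaussianDenoising

/-- The space `ℝ^d` with its Euclidean norm. -/
abbrev Space (d : ℕ) : Type := EuclideanSpace ℝ (Fin d)

open scoped MatrixOrder Matrix.Norms.L2Operator in
lemma measurable_noise (d : ℕ) (σ : ℝ) :
    Measurable fun x : Space d =>
      multivariateGaussian x (σ ^ 2 • (1 : Matrix (Fin d) (Fin d) ℝ)) := by
  refine Measure.measurable_of_measurable_coe _ fun s hs => ?_
  set L := Matrix.toEuclideanCLM (𝕜 := ℝ) (CFC.sqrt (σ ^ 2 • (1 : Matrix (Fin d) (Fin d) ℝ)))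
  have h : Measurable fun p : Space d × Space d => p.1 + L p.2 := by fun_prop
  have e : (fun x : Space d =>
      multivariateGaussian x (σ ^ 2 • (1 : Matrix (Fin d) (Fin d) ℝ)) s) =
      fun x => stdGaussian (Space d)
        (Prod.mk x ⁻¹' ((fun p : Space d × Space d => p.1 + L p.2) ⁻¹' s)) := by
    funext x
    exact Measure.map_apply (by fun_prop) hs
  rw [e]
  exact measurable_measure_prodMk_left (h hs)

/-- The noise model `p(x̃ | x) = N(x, σ² I)` as a Markov kernel. -/
noncomputable def noise (d : ℕ) (σ : ℝ) : Kernel (Space d) (Space d) where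
  toFun x := multivariateGaussian x (σ ^ 2 • (1 : Matrix (Fin d) (Fin d) ℝ))
  measurable' := measurable_noise d σ

instance isMarkovKernel_noise (d : ℕ) (σ : ℝ) : IsMarkovKernel (noise d σ) :=
  ⟨fun x => inferInstanceAs (IsProbabilityMeasure
    (multivariateGaussian x (σ ^ 2 • (1 : Matrix (Fin d) (Fin d) ℝ))))⟩

/-- The noised data distribution `p̃_d(x̃) = ∫ p(x̃ | x) p_d(x) dx`. -/
noncomputable def noisedData {d : ℕ} (pd : Measure (Space d)) (σ : ℝ) : Measure (Space d) :=
  pd.bind (noise d σ)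

/-- The true joint law `p(x̃ | x) p_d(x)`, as a law of the pair `(x̃, x)`. -/
noncomputable def trueJoint {d : ℕ} (pd : Measure (Space d)) (σ : ℝ) :
    Measure (Space d × Space d) :=
  (pd ⊗ₘ noise d σ).map Prod.swap

/-- The model joint law `q(x | x̃) p̃_d(x̃)`, as a law of the pair `(x̃, x)`. -/
noncomputable def modelJoint {d : ℕ} (pd : Measure (Space d)) (σ : ℝ)
    (q : Kernel (Space d) (Space d)) : Measure (Space d × Space d) :=
  noisedData pd σ ⊗ₘ q

/-- The joint divergence `KL(p(x̃ | x) p_d(x) ‖ q(x | x̃) p̃_d(x̃))`, with values in `[0, ∞]`. -/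
noncomputable def jointKL {d : ℕ} (pd : Measure (Space d)) (σ : ℝ)
    (q : Kernel (Space d) (Space d)) : ℝ≥0∞ :=
  InformationTheory.klDiv (trueJoint pd σ) (modelJoint pd σ q)

/-- `q(x | x̃) = N(m(x̃), S(x̃))` for every `x̃`, with `S(x̃)` a positive semidefinite matrix. -/
def HasGaussianParams {d : ℕ} (q : Kernel (Space d) (Space d)) (m : Space d → Space d)
    (S : Space d → Matrix (Fin d) (Fin d) ℝ) : Prop :=
  ∀ y, (S y).PosSemidef ∧ q y = multivariateGaussian (m y) (S y)

/-- The Gaussian conditionals, over which the joint divergence is minimised. -/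
def gaussianConditionals (d : ℕ) : Set (Kernel (Space d) (Space d)) :=
  {q | ∃ m S, HasGaussianParams q m S}

/-- The true posterior at every point `y`, by Bayes' rule: the probability measure whose density
with respect to `p_d` is proportional to `x ↦ exp (-‖y - x‖² / (2σ²))`, the likelihood `p(y | x)`
up to a constant factor. -/
noncomputable def truePosterior {d : ℕ} (pd : Measure (Space d)) (σ : ℝ) (y : Space d) :
    Measure (Space d) :=
  pd.tilted fun x => -‖y - x‖ ^ 2 / (2 * σ ^ 2)

/-- The mean of the true posterior. -/
noncomputable def posteriorMean {d : ℕ} (pd : Measure (Space d)) (σ : ℝ) (y : Space d) : Space d :=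
  ∫ x, x ∂(truePosterior pd σ y)

/-- The Jacobian matrix `(∂ f_i / ∂ y_j)` of a map `ℝ^d → ℝ^d`. -/
noncomputable def jacobian {d : ℕ} (f : Space d → Space d) (y : Space d) :
    Matrix (Fin d) (Fin d) ℝ :=
  Matrix.of fun i j => (fderiv ℝ f y (EuclideanSpace.single j 1)) i

end GaussianDenoising

/-! Both joint laws have the same x̃-marginal, and Bayes' rule (`trueJoint_eq_compProd`)
disintegrates the true one along the posterior. When the posterior is absolutely continuous with
respect to q for almost every x̃, which finiteness of J forces, J(q) is therefore the average over
x̃ of the fibrewise divergence (`jointKL_eq_lintegral`). What remains is to approximate one law P,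
the posterior at x̃, by a Gaussian.

For fixed P the answer is moment matching. The log-ratio of two nondegenerate Gaussians is a
quadratic polynomial, so it has the same mean under P and under the Gaussian G with the mean and
covariance of P. This gives KL(P‖N) = KL(P‖G) + KL(G‖N) (`klDiv_multivariateGaussian_eq_add`), whose
last term vanishes only for N = G. A singular N lives on a hyperplane, which is null for P, so it is
excluded (`not_absolutelyContinuous_multivariateGaussian`).

Finally, the posterior covariance is σ² times the Jacobian of the posterior mean: differentiating
the likelihood in x̃ brings down (x - x̃)/σ², and the quotient rule assembles a covariance
(`hasFDerivAt_posteriorMean`). The decay of the likelihood supplies the moments and the domination,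
so p_d needs no moment assumption. Its density makes the covariance positive definite. -/

namespace GaussianDenoising

/-! ### Gaussian measures as normalised exponential densities. -/

open Real in
lemma stdGaussian_eq_tilted (d : ℕ) :
    stdGaussian (Space d) = (volume : Measure (Space d)).tilted fun x => -‖x‖ ^ 2 / 2 := by
  have hZ := GaussianFourier.integral_rexp_neg_mul_sq_norm (V := Space d) (b := 1 / 2) (by norm_num)
  have hZ0 : (0 : ℝ) < (π / (1 / 2)) ^ (Module.finrank ℝ (Space d) / 2 : ℝ) := by positivity
  have hi : Integrable (fun x : Space d => rexp (-‖x‖ ^ 2 / 2)) := by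
    refine Integrable.of_integral_ne_zero ?_
    rw [show (fun x : Space d => rexp (-‖x‖ ^ 2 / 2)) = fun x => rexp (-(1 / 2) * ‖x‖ ^ 2) by
      ext x; congr 1; ring, hZ]
    exact hZ0.ne'
  have := isProbabilityMeasure_tilted hi
  -- `stdGaussian` is not defined through a Lebesgue density, so the two measures are compared by
  -- their Fourier transforms.
  apply Measure.ext_of_charFun
  ext t
  rw [charFun_stdGaussian, charFun_apply, integral_tilted]
  have h2 := GaussianFourier.integral_cexp_neg_mul_sq_norm_add (V := Space d) (b := 1 / 2)
    (by norm_num) Complex.I t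
  have h3 := GaussianFourier.integral_cexp_neg_mul_sq_norm (V := Space d) (b := 1 / 2)
    (by norm_num)
  have hZc : ((∫ x : Space d, rexp (-‖x‖ ^ 2 / 2) : ℝ) : ℂ) =
      ((π : ℂ) / (1 / 2)) ^ (Module.finrank ℝ (Space d) / 2 : ℂ) := by
    rw [← integral_complex_ofReal, ← h3]
    congr 1; ext x; push_cast; congr 1; ring
  have hne : ((∫ x : Space d, rexp (-‖x‖ ^ 2 / 2) : ℝ) : ℂ) ≠ 0 := by
    exact_mod_cast (integral_exp_pos hi).ne'
  have : ∀ x : Space d, (rexp (-‖x‖ ^ 2 / 2) / ∫ x : Space d, rexp (-‖x‖ ^ 2 / 2)) •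
      Complex.exp (inner ℝ x t * Complex.I) =
      ((∫ x : Space d, rexp (-‖x‖ ^ 2 / 2) : ℝ) : ℂ)⁻¹ *
        Complex.exp (-(1 / 2) * ‖x‖ ^ 2 + Complex.I * inner ℝ t x) := by
    intro x
    rw [Complex.exp_add, Complex.real_smul, real_inner_comm]
    push_cast
    rw [show -(1 / 2 : ℂ) * ‖x‖ ^ 2 = -‖x‖ ^ 2 / 2 by ring, mul_comm (Complex.I)]
    ring
  simp_rw [this]
  rw [integral_const_mul, h2, ← hZc, inv_mul_cancel_left₀ hne]
  congr 1
  rw [Complex.I_sq]; ring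

/-- The normalisation built into `tilted` cancels the Jacobian factor `c`, so affine changes of
variables leave no determinant to track. -/
lemma map_tilted_measurableEquiv {α : Type*} [MeasurableSpace α] {μ : Measure α} (e : α ≃ᵐ α)
    {c : ℝ≥0∞} (hc0 : c ≠ 0) (hc : c ≠ ∞) (he : μ.map e = c • μ) (f : α → ℝ) :
    (μ.tilted f).map e = μ.tilted (f ∘ e.symm) := by
  have hμ : μ = c⁻¹ • μ.map e := by
    rw [he, smul_smul, ENNReal.inv_mul_cancel hc0 hc, one_smul]
  have hZ : ∫ x, Real.exp (f x) ∂μ = c.toReal * ∫ x, Real.exp ((f ∘ e.symm) x) ∂μ := by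
    rw [← smul_eq_mul, ← integral_smul_measure, ← he, integral_map_equiv]
    simp
  have hcr : 0 < c.toReal := ENNReal.toReal_pos hc0 hc
  ext s hs
  rw [e.map_apply, tilted_apply' _ _ (e.measurable hs), tilted_apply' _ _ hs, hZ]
  generalize ∫ x, Real.exp ((f ∘ e.symm) x) ∂μ = Z
  conv_rhs => rw [hμ]
  rw [Measure.restrict_smul, lintegral_smul_measure, e.restrict_map, lintegral_map_equiv,
    smul_eq_mul, ← lintegral_const_mul' _ _ (ENNReal.inv_ne_top.2 hc0)]
  congr 1
  ext x
  rw [← ENNReal.ofReal_toReal (ENNReal.inv_ne_top.2 hc0), ← ENNReal.ofReal_mul (by positivity),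
    ENNReal.toReal_inv]
  congr 1
  simp only [Function.comp, e.symm_apply_apply]
  field_simp

open Matrix in
/-- The exponent of the Gaussian density with mean `m` and precision matrix `A`. -/
noncomputable def gaussianExponent {d : ℕ} (m : Space d) (A : Matrix (Fin d) (Fin d) ℝ)
    (x : Space d) : ℝ :=
  -((x - m).ofLp ⬝ᵥ A *ᵥ (x - m).ofLp) / 2

open scoped MatrixOrder Matrix.Norms.L2Operator in
open Matrix in
lemma multivariateGaussian_eq_tilted {d : ℕ} (m : Space d) {S : Matrix (Fin d) (Fin d) ℝ}
    (hS : S.PosDef) :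
    multivariateGaussian m S = volume.tilted (gaussianExponent m S⁻¹) := by
  set R := CFC.sqrt S with hR
  have hRR : R * R = S := CFC.sqrt_mul_sqrt_self _ hS.posSemidef.nonneg
  have hRu : IsUnit R.det := by
    have : R.det * R.det = S.det := by rw [← det_mul, hRR]
    have := hS.det_pos
    exact isUnit_iff_ne_zero.2 fun h => by simp_all
  have hRs : Rᵀ = R := by
    have : IsSelfAdjoint R := (CFC.sqrt_nonneg S).isSelfAdjoint
    rw [← conjTranspose_eq_transpose_of_trivial]
    exact this.star_eq
  have hinv : R⁻¹ * R⁻¹ = S⁻¹ := by rw [← Matrix.mul_inv_rev, hRR]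
  set T := toEuclideanCLM (𝕜 := ℝ) R
  set T' := toEuclideanCLM (𝕜 := ℝ) R⁻¹
  have hTT' : ∀ x, T (T' x) = x := fun x => by
    rw [← mul_apply_eq_comp, ← map_mul, mul_nonsing_inv _ hRu]; simp
  have hT'T : ∀ x, T' (T x) = x := fun x => by
    rw [← mul_apply_eq_comp, ← map_mul, nonsing_inv_mul _ hRu]; simp
  let e : Space d ≃ᵐ Space d :=
    { toFun := fun x => m + T x
      invFun := fun x => T' (x - m)
      left_inv := fun x => by simp [hT'T]
      right_inv := fun x => by simp [hTT']
      measurable_toFun := by change Measurable fun x => m + T x; fun_prop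
      measurable_invFun := by change Measurable fun x => T' (x - m); fun_prop }
  have hdet : LinearMap.det (T : Space d →ₗ[ℝ] Space d) ≠ 0 := by
    have : (T : Space d →ₗ[ℝ] Space d) * (T' : Space d →ₗ[ℝ] Space d) = 1 := by
      ext1 x; exact hTT' x
    intro h
    have := congrArg LinearMap.det this
    rw [map_mul, h] at this
    simp at this
  have he : (volume : Measure (Space d)).map e =
      ENNReal.ofReal |(LinearMap.det (T : Space d →ₗ[ℝ] Space d))⁻¹| • volume := by
    have : (e : Space d → Space d) = (fun x => m + x) ∘ ⇑T := rfl
    rw [this, ← Measure.map_map (measurable_const_add m) T.continuous.measurable,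
      show (⇑T) = ⇑(T : Space d →ₗ[ℝ] Space d) from rfl,
      Measure.map_linearMap_addHaar_eq_smul_addHaar _ hdet, Measure.map_smul,
      map_add_left_eq_self]
  have := map_tilted_measurableEquiv e (by simpa using hdet) ENNReal.ofReal_ne_top he
    (fun x => -‖x‖ ^ 2 / 2)
  rw [← stdGaussian_eq_tilted] at this
  change (stdGaussian (Space d)).map e = _
  rw [this]
  congr 1
  ext x
  change -‖T' (x - m)‖ ^ 2 / 2 = _
  -- Since `R⁻¹` is symmetric with square `S⁻¹`, the squared norm of `R⁻¹ (x - m)` is the quadratic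
  -- form of `S⁻¹`.
  rw [gaussianExponent, ← hinv, ← real_inner_self_eq_norm_sq, inner_toEuclideanCLM,
    ofLp_toEuclideanCLM, ← mulVec_mulVec, dotProduct_mulVec _ R⁻¹, ← mulVec_transpose,
    transpose_nonsing_inv, hRs, dotProduct_comm]

/-! ### Moments and the Pythagorean identity. -/

variable {d : ℕ}

/-- The measure `ρ` has finite second moments, mean `μ` and covariance matrix `C`. -/
structure HasMoments (ρ : Measure (Space d)) (μ : Space d) (C : Matrix (Fin d) (Fin d) ℝ) :
    Prop where
  memLp : ∀ i, MemLp (fun x : Space d => x i) 2 ρ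
  mean : ∀ i, ∫ x, x i ∂ρ = μ i
  cov : ∀ i j, ∫ x, (x i - μ i) * (x j - μ j) ∂ρ = C i j

lemma gaussianExponent_eq_sum (m : Space d) (A : Matrix (Fin d) (Fin d) ℝ) (x : Space d) :
    gaussianExponent m A x = -(∑ i, ∑ j, A i j * ((x i - m i) * (x j - m j))) / 2 := by
  simp only [gaussianExponent, dotProduct, Matrix.mulVec, Finset.mul_sum, PiLp.sub_apply]
  congr 2
  refine Finset.sum_congr rfl fun i _ => Finset.sum_congr rfl fun j _ => ?_
  ring

namespace HasMoments

variable {ρ : Measure (Space d)} [IsProbabilityMeasure ρ] {μ : Space d}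
  {C : Matrix (Fin d) (Fin d) ℝ}

lemma integrable_mul (h : HasMoments ρ μ C) (m : Space d) (i j : Fin d) :
    Integrable (fun x => (x i - m i) * (x j - m j)) ρ :=
  ((h.memLp i).sub (memLp_const (m i))).integrable_mul ((h.memLp j).sub (memLp_const (m j)))

lemma integral_mul (h : HasMoments ρ μ C) (m : Space d) (i j : Fin d) :
    ∫ x, (x i - m i) * (x j - m j) ∂ρ = C i j + (μ i - m i) * (μ j - m j) := by
  have hi : ∀ i, Integrable (fun x : Space d => x i) ρ := fun i =>
    (h.memLp i).integrable (by norm_num)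
  have hd : ∀ i (c : ℝ), Integrable (fun x : Space d => (x i - μ i) * c) ρ := fun i c =>
    ((hi i).sub (integrable_const _)).mul_const c
  have e : ∀ x : Space d, (x i - m i) * (x j - m j) = (x i - μ i) * (x j - μ j) +
      ((x i - μ i) * (μ j - m j) + ((x j - μ j) * (μ i - m i) + (μ i - m i) * (μ j - m j))) := by
    intro x; ring
  have hz : ∀ i, ∫ x : Space d, (x i - μ i) ∂ρ = 0 := fun i => by
    rw [integral_sub (hi i) (integrable_const _), h.mean]; simp
  have hA : ∀ a b, Integrable (fun x : Space d => (x j - μ j) * a + b) ρ := fun a b =>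
    (hd j a).add (integrable_const b)
  have hB : ∀ a b c, Integrable
      (fun x : Space d => (x i - μ i) * a + ((x j - μ j) * b + c)) ρ := fun a b c =>
    (hd i a).add (hA b c)
  rw [integral_congr_ae (.of_forall e), integral_add (h.integrable_mul μ i j) (hB _ _ _),
    integral_add (hd i _) (hA _ _), integral_add (hd j _) (integrable_const _),
    integral_mul_const, integral_mul_const, hz, hz, h.cov]
  simp

lemma integrable_gaussianExponent (h : HasMoments ρ μ C) (m : Space d)
    (A : Matrix (Fin d) (Fin d) ℝ) : Integrable (gaussianExponent m A) ρ := by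
  simp_rw [funext (gaussianExponent_eq_sum m A)]
  refine (integrable_finsetSum _ fun i _ => integrable_finsetSum _ fun j _ => ?_).neg.div_const 2
  exact (h.integrable_mul m i j).const_mul _

/-- The exponent is quadratic, so its integral sees `ρ` only through `μ` and `C`. Hence it cannot
distinguish a law from the Gaussian with the same moments. -/
lemma integral_gaussianExponent (h : HasMoments ρ μ C) (m : Space d)
    (A : Matrix (Fin d) (Fin d) ℝ) : ∫ x, gaussianExponent m A x ∂ρ =
      -(∑ i, ∑ j, A i j * (C i j + (μ i - m i) * (μ j - m j))) / 2 := by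
  simp_rw [gaussianExponent_eq_sum m A]
  have hI : ∀ i j, Integrable (fun x : Space d => A i j * ((x i - m i) * (x j - m j))) ρ :=
    fun i j => (h.integrable_mul m i j).const_mul _
  rw [integral_div, integral_neg,
    integral_finsetSum _ fun i _ => integrable_finsetSum _ fun j _ => hI i j]
  simp_rw [integral_finsetSum _ fun j _ => hI _ j, integral_const_mul, h.integral_mul]

end HasMoments

lemma hasMoments_multivariateGaussian (μ : Space d) {C : Matrix (Fin d) (Fin d) ℝ}
    (hC : C.PosSemidef) : HasMoments (multivariateGaussian μ C) μ C := by
  have hm : ∀ i, ∫ x : Space d, x i ∂(multivariateGaussian μ C) = μ i := fun i => by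
    have := (EuclideanSpace.proj (𝕜 := ℝ) i).integral_comp_comm
      (IsGaussian.integrable_id (μ := multivariateGaussian μ C))
    simpa using this
  refine ⟨fun i => ?_, hm, fun i j => ?_⟩
  · exact (EuclideanSpace.proj (𝕜 := ℝ) i).comp_memLp'
      (IsGaussian.memLp_two_id (μ := multivariateGaussian μ C))
  · rw [← covariance_eval_multivariateGaussian (μ := μ) hC i j, covariance, hm, hm]

lemma integrable_exp_of_tilted_ne_zero {α : Type*} [MeasurableSpace α] {μ : Measure α}
    {f : α → ℝ} (h : μ.tilted f ≠ 0) : Integrable (fun x => Real.exp (f x)) μ := by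
  by_contra hf
  exact h (tilted_of_not_integrable hf)

lemma integrable_exp_gaussianExponent (m : Space d) {S : Matrix (Fin d) (Fin d) ℝ}
    (hS : S.PosDef) : Integrable fun x => Real.exp (gaussianExponent m S⁻¹ x) := by
  refine integrable_exp_of_tilted_ne_zero ?_
  rw [← multivariateGaussian_eq_tilted m hS]
  exact IsProbabilityMeasure.ne_zero _

lemma volume_absolutelyContinuous_multivariateGaussian (m : Space d)
    {S : Matrix (Fin d) (Fin d) ℝ} (hS : S.PosDef) : volume ≪ multivariateGaussian m S := by
  rw [multivariateGaussian_eq_tilted m hS]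
  exact absolutelyContinuous_tilted (integrable_exp_gaussianExponent m hS)

lemma multivariateGaussian_eq_tilted_multivariateGaussian (μ m : Space d)
    {C S : Matrix (Fin d) (Fin d) ℝ} (hC : C.PosDef) (hS : S.PosDef) :
    multivariateGaussian m S =
      (multivariateGaussian μ C).tilted (gaussianExponent m S⁻¹ - gaussianExponent μ C⁻¹) := by
  rw [multivariateGaussian_eq_tilted m hS, multivariateGaussian_eq_tilted μ hC,
    tilted_tilted (integrable_exp_gaussianExponent μ hC), add_sub_cancel]

/-- Tilting changes the log-likelihood ratio against `Q` by `-f` plus the log-normaliser. By `hPf`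
this correction has the same mean under `P` and `Q`, and under `Q` that mean is the second
divergence. -/
lemma klDiv_tilted_right_of_isProbabilityMeasure {α : Type*} [MeasurableSpace α]
    {P Q : Measure α} [IsProbabilityMeasure P] [IsProbabilityMeasure Q] (hPQ : P ≪ Q)
    {f : α → ℝ} (hf : Integrable (fun x => Real.exp (f x)) Q) (hfP : Integrable f P)
    (hfQ : Integrable f Q) (hPf : ∫ x, f x ∂P = ∫ x, f x ∂Q) :
    InformationTheory.klDiv P (Q.tilted f) =
      InformationTheory.klDiv P Q + InformationTheory.klDiv Q (Q.tilted f) := by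
  have := isProbabilityMeasure_tilted hf
  have hQT : Q ≪ Q.tilted f := absolutelyContinuous_tilted hf
  have hQQ : Integrable (llr Q Q) Q := by
    rw [integrable_congr (llr_self Q)]; exact integrable_zero _ _ _
  have hPT := hPQ.trans hQT
  by_cases hi : Integrable (llr P Q) P
  · have hiP := integrable_llr_tilted_right hPQ hfP hi hf
    have hiQ := integrable_llr_tilted_right Measure.AbsolutelyContinuous.rfl hfQ hQQ hf
    have h1 := InformationTheory.integral_llr_add_sub_measure_univ_nonneg hPQ hi
    have h2 := InformationTheory.integral_llr_add_sub_measure_univ_nonneg hQT hiQ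
    rw [InformationTheory.klDiv_of_ac_of_integrable hPT hiP,
      InformationTheory.klDiv_of_ac_of_integrable hPQ hi,
      InformationTheory.klDiv_of_ac_of_integrable hQT hiQ, ← ENNReal.ofReal_add h1 h2,
      integral_llr_tilted_right hPQ hfP hf hi,
      integral_llr_tilted_right Measure.AbsolutelyContinuous.rfl hfQ hf hQQ,
      integral_congr_ae (llr_self Q), hPf]
    congr 1
    simp
    ring
  -- The two log-ratios differ by a `P`-integrable function, so both divergences from `P` are
  -- infinite together.
  · have hiT : ¬ Integrable (llr P (Q.tilted f)) P := fun h => hi <| by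
      rw [integrable_congr (llr_tilted_right hPQ hf)] at h
      have := (h.add hfP).sub (integrable_const (Real.log (∫ z, Real.exp (f z) ∂Q)))
      refine this.congr (.of_forall fun x => ?_)
      simp only [Pi.sub_apply, Pi.add_apply]
      ring
    rw [InformationTheory.klDiv_of_not_integrable hi, InformationTheory.klDiv_of_not_integrable hiT,
      top_add]

/-- The Pythagorean identity for moment matching by a Gaussian. -/
lemma klDiv_multivariateGaussian_eq_add {P : Measure (Space d)} [IsProbabilityMeasure P]
    (hP : P ≪ volume) {μ : Space d} {C : Matrix (Fin d) (Fin d) ℝ} (hPm : HasMoments P μ C)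
    (hC : C.PosDef) (m : Space d) {S : Matrix (Fin d) (Fin d) ℝ} (hS : S.PosDef) :
    InformationTheory.klDiv P (multivariateGaussian m S) =
      InformationTheory.klDiv P (multivariateGaussian μ C) +
        InformationTheory.klDiv (multivariateGaussian μ C) (multivariateGaussian m S) := by
  have hG := hasMoments_multivariateGaussian μ hC.posSemidef
  have e := multivariateGaussian_eq_tilted_multivariateGaussian μ m hC hS
  rw [e]
  refine klDiv_tilted_right_of_isProbabilityMeasure
    (hP.trans (volume_absolutelyContinuous_multivariateGaussian μ hC)) ?_
    ((hPm.integrable_gaussianExponent _ _).sub (hPm.integrable_gaussianExponent _ _))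
    ((hG.integrable_gaussianExponent _ _).sub (hG.integrable_gaussianExponent _ _)) ?_
  · refine integrable_exp_of_tilted_ne_zero ?_
    rw [← e]
    exact IsProbabilityMeasure.ne_zero _
  · simp only [Pi.sub_apply]
    rw [integral_sub (hPm.integrable_gaussianExponent _ _) (hPm.integrable_gaussianExponent _ _),
      integral_sub (hG.integrable_gaussianExponent _ _) (hG.integrable_gaussianExponent _ _)]
    simp only [hPm.integral_gaussianExponent, hG.integral_gaussianExponent]

lemma multivariateGaussian_injective {μ m : Space d} {C S : Matrix (Fin d) (Fin d) ℝ}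
    (hC : C.PosSemidef) (hS : S.PosSemidef)
    (h : multivariateGaussian μ C = multivariateGaussian m S) : μ = m ∧ C = S := by
  constructor
  · rw [← integral_id_multivariateGaussian (μ := μ) (S := C), h, integral_id_multivariateGaussian]
  · ext i j
    rw [← covariance_eval_multivariateGaussian (μ := μ) hC i j, h,
      covariance_eval_multivariateGaussian hS]

/-! ### Hyperplanes and degenerate covariances. -/

lemma volume_hyperplane {v : Space d} (hv : v ≠ 0) (m : Space d) :
    volume {x : Space d | inner ℝ v (x - m) = 0} = 0 := by
  have h : {x : Space d | inner ℝ v (x - m) = 0} =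
      (fun x => x + -m) ⁻¹' ((innerSL ℝ v).ker : Set (Space d)) := by
    ext x; simp [sub_eq_add_neg]
  rw [h, measure_preimage_add_right]
  refine Measure.addHaar_submodule _ _ fun ht => hv ?_
  have : v ∈ (innerSL ℝ v).ker := ht ▸ Submodule.mem_top
  simpa using this

-- For `v` in the kernel of `S`, the Gaussian is carried by the hyperplane through `m` orthogonal to
-- `v`. That set is Lebesgue null, hence `P`-null, while `P` has mass one.
open scoped MatrixOrder Matrix.Norms.L2Operator in
open Matrix in
lemma not_absolutelyContinuous_multivariateGaussian {P : Measure (Space d)}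
    [IsProbabilityMeasure P] (hP : P ≪ volume) (m : Space d) {S : Matrix (Fin d) (Fin d) ℝ}
    (hS : S.PosSemidef) (hS' : ¬ S.PosDef) : ¬ P ≪ multivariateGaussian m S := by
  intro hPG
  rw [hS.posDef_iff_det_ne_zero, not_not, ← Matrix.exists_mulVec_eq_zero_iff] at hS'
  obtain ⟨v, hv, hSv⟩ := hS'
  set R := CFC.sqrt S with hR
  have hRR : R * R = S := CFC.sqrt_mul_sqrt_self _ hS.nonneg
  have hRs : Rᵀ = R := by
    have : IsSelfAdjoint R := (CFC.sqrt_nonneg S).isSelfAdjoint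
    rw [← conjTranspose_eq_transpose_of_trivial]
    exact this.star_eq
  -- The squared norm of `R v` is the quadratic form of `S` at `v`, which is zero.
  have hRv : R *ᵥ v = 0 := by
    rw [← dotProduct_self_eq_zero, dotProduct_mulVec, ← mulVec_transpose, hRs, mulVec_mulVec,
      hRR, hSv, zero_dotProduct]
  set w : Space d := WithLp.toLp 2 v
  have hw : w ≠ 0 := fun h => hv (by simpa [w] using h)
  have hm : MeasurableSet {x : Space d | inner ℝ w (x - m) = 0} :=
    measurableSet_eq_fun (by fun_prop) measurable_const
  have h0 : multivariateGaussian m S {x : Space d | inner ℝ w (x - m) = 0}ᶜ = 0 := by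
    rw [multivariateGaussian, Measure.map_apply (by fun_prop) hm.compl]
    convert measure_empty (μ := stdGaussian (Space d))
    ext z
    have : v ⬝ᵥ R *ᵥ z.ofLp = 0 := by
      rw [dotProduct_mulVec, ← mulVec_transpose, hRs, hRv, zero_dotProduct]
    simpa [inner_toEuclideanCLM, w] using this
  have h1 := hPG h0
  have h2 := hP (volume_hyperplane hw m)
  rw [prob_compl_eq_zero_iff hm] at h1
  simp [h1] at h2

/-- The quadratic form of `C` at `v` is the variance of the inner product with `v`. It could vanish
only if `P` were concentrated on a hyperplane. -/
lemma HasMoments.posDef {P : Measure (Space d)} [IsProbabilityMeasure P] (hP : P ≪ volume)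
    {μ : Space d} {C : Matrix (Fin d) (Fin d) ℝ} (h : HasMoments P μ C) : C.PosDef := by
  refine Matrix.PosDef.of_dotProduct_mulVec_pos ?_ fun v hv => ?_
  · ext i j
    simp [← h.cov, mul_comm]
  have e : ∀ x : Space d, (inner ℝ (WithLp.toLp 2 v) (x - μ)) ^ 2 =
      ∑ i, ∑ j, (v i * v j) * ((x i - μ i) * (x j - μ j)) := fun x => by
    rw [PiLp.inner_apply, sq, Finset.sum_mul_sum]
    refine Finset.sum_congr rfl fun i _ => Finset.sum_congr rfl fun j _ => ?_
    simp
    ring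
  have hI : ∀ i j, Integrable (fun x : Space d => (v i * v j) * ((x i - μ i) * (x j - μ j))) P :=
    fun i j => (h.integrable_mul μ i j).const_mul _
  have hint : Integrable (fun x : Space d => (inner ℝ (WithLp.toLp 2 v) (x - μ)) ^ 2) P := by
    rw [funext e]
    exact integrable_finsetSum _ fun i _ => integrable_finsetSum _ fun j _ => hI i j
  have hval : star v ⬝ᵥ C.mulVec v = ∫ x, (inner ℝ (WithLp.toLp 2 v) (x - μ)) ^ 2 ∂P := by
    rw [integral_congr_ae (.of_forall e),
      integral_finsetSum _ fun i _ => integrable_finsetSum _ fun j _ => hI i j]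
    simp_rw [integral_finsetSum _ fun j _ => hI _ j, integral_const_mul, h.cov, dotProduct,
      Matrix.mulVec, dotProduct, Finset.mul_sum]
    refine Finset.sum_congr rfl fun i _ => Finset.sum_congr rfl fun j _ => ?_
    simp
    ring
  rw [hval, integral_pos_iff_support_of_nonneg (fun x => sq_nonneg _) hint]
  have hw : (WithLp.toLp 2 v : Space d) ≠ 0 := fun h => hv (by simpa using h)
  have h0 := hP (volume_hyperplane hw μ)
  have hm : MeasurableSet {x : Space d | inner ℝ (WithLp.toLp 2 v : Space d) (x - μ) = 0} :=
    measurableSet_eq_fun (by fun_prop) measurable_const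
  have hs : Function.support (fun x : Space d => (inner ℝ (WithLp.toLp 2 v) (x - μ)) ^ 2) =
      {x : Space d | inner ℝ (WithLp.toLp 2 v : Space d) (x - μ) = 0}ᶜ := by
    ext x; simp
  rw [hs, prob_compl_eq_one_sub hm, h0]
  simp

/-! ### The likelihood: integrability and differentiation under the integral. -/

/-- The unnormalised likelihood `exp (-‖y - x‖² / (2σ²))`. -/
noncomputable def likelihood (σ : ℝ) (y x : Space d) : ℝ :=
  Real.exp (-‖y - x‖ ^ 2 / (2 * σ ^ 2))

lemma likelihood_pos (σ : ℝ) (y x : Space d) : 0 < likelihood σ y x := Real.exp_pos _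

lemma continuous_likelihood (σ : ℝ) :
    Continuous fun p : Space d × Space d => likelihood σ p.1 p.2 := by
  unfold likelihood; fun_prop

/-- Quadratic growth is all that second moments and the derivative of the mean require. The constant
combines `(1 + r)² ≤ 2 (1 + r²)`, likelihood at most 1, and `u * exp (-u) ≤ 1` at `u = r² / (2σ²)`.
-/
lemma likelihood_mul_le {σ : ℝ} (hσ : 0 < σ) (y x : Space d) :
    likelihood σ y x * (1 + ‖y - x‖) ^ 2 ≤ 2 * (1 + 2 * σ ^ 2) := by
  have hle : likelihood σ y x ≤ 1 := Real.exp_le_one_iff.2 (by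
    rw [neg_div]; exact neg_nonpos.2 (by positivity))
  have h2 : likelihood σ y x * ‖y - x‖ ^ 2 ≤ 2 * σ ^ 2 := by
    set u := ‖y - x‖ ^ 2 / (2 * σ ^ 2) with hu
    have h1 : u ≤ Real.exp u := by linarith [Real.add_one_le_exp u]
    have h3 : ‖y - x‖ ^ 2 = u * (2 * σ ^ 2) := by rw [hu]; field_simp
    have h4 : likelihood σ y x = Real.exp (-u) := by rw [likelihood, hu, neg_div]
    have h5 : Real.exp (-u) * u ≤ 1 := by
      rw [Real.exp_neg, inv_mul_le_iff₀ (Real.exp_pos u)]; simpa using h1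
    rw [h4, h3, ← mul_assoc]
    exact mul_le_of_le_one_left (by positivity) h5
  have h0 := (likelihood_pos σ y x).le
  nlinarith [sq_nonneg (1 - ‖y - x‖)]

section Posterior

variable {E : Type*} [NormedAddCommGroup E] [NormedSpace ℝ E]

lemma norm_likelihood_smul_le {σ : ℝ} (hσ : 0 < σ) {c : ℝ} {y x : Space d} {v : E}
    (hv : ‖v‖ ≤ c * (1 + ‖y - x‖) ^ 2) :
    ‖likelihood σ y x • v‖ ≤ c * (2 * (1 + 2 * σ ^ 2)) := by
  have hc : 0 ≤ c := by
    by_contra! hc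
    have : c * (1 + ‖y - x‖) ^ 2 < 0 := mul_neg_of_neg_of_pos hc (by positivity)
    linarith [norm_nonneg v]
  rw [norm_smul, Real.norm_of_nonneg (likelihood_pos σ y x).le]
  calc likelihood σ y x * ‖v‖ ≤ likelihood σ y x * (c * (1 + ‖y - x‖) ^ 2) :=
        mul_le_mul_of_nonneg_left hv (likelihood_pos σ y x).le
    _ = c * (likelihood σ y x * (1 + ‖y - x‖) ^ 2) := by ring
    _ ≤ _ := mul_le_mul_of_nonneg_left (likelihood_mul_le hσ y x) hc

variable {pd : Measure (Space d)} [IsProbabilityMeasure pd] {σ : ℝ}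

lemma integrable_likelihood_smul (hσ : 0 < σ) (y : Space d) {f : Space d → E}
    [SecondCountableTopologyEither (Space d) E]
    (hf : Continuous f) {c : ℝ} (hc : ∀ x, ‖f x‖ ≤ c * (1 + ‖y - x‖) ^ 2) :
    Integrable (fun x => likelihood σ y x • f x) pd := by
  refine Integrable.of_bound (C := c * (2 * (1 + 2 * σ ^ 2))) ?_
    (.of_forall fun x => norm_likelihood_smul_le hσ (hc x))
  have := (continuous_likelihood σ).comp (Continuous.prodMk_right y)
  exact (this.smul hf).aestronglyMeasurable

lemma integrable_likelihood (hσ : 0 < σ) (y : Space d) : Integrable (likelihood σ y) pd := by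
  have := integrable_likelihood_smul (pd := pd) hσ y (f := fun _ => (1 : ℝ)) continuous_const
    (c := 1) fun x => by
      rw [norm_one, one_mul]
      exact one_le_pow₀ (by linarith [norm_nonneg (y - x)])
  simpa using this

lemma integral_likelihood_pos (hσ : 0 < σ) (y : Space d) : 0 < ∫ x, likelihood σ y x ∂pd :=
  integral_exp_pos (integrable_likelihood hσ y)

lemma isProbabilityMeasure_truePosterior (hσ : 0 < σ) (y : Space d) :
    IsProbabilityMeasure (truePosterior pd σ y) :=
  isProbabilityMeasure_tilted (integrable_likelihood hσ y)

lemma integrable_truePosterior (hσ : 0 < σ) (y : Space d) {f : Space d → E}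
    [SecondCountableTopologyEither (Space d) E]
    (hf : Continuous f) {c : ℝ} (hc : ∀ x, ‖f x‖ ≤ c * (1 + ‖y - x‖) ^ 2) :
    Integrable f (truePosterior pd σ y) :=
  (integrable_tilted_iff (integrable_likelihood hσ y) f).2 (integrable_likelihood_smul hσ y hf hc)

omit [IsProbabilityMeasure pd] in
lemma integral_truePosterior (y : Space d) (f : Space d → E) :
    ∫ x, f x ∂(truePosterior pd σ y) =
      (∫ x, likelihood σ y x ∂pd)⁻¹ • ∫ x, likelihood σ y x • f x ∂pd := by
  rw [truePosterior, integral_tilted, ← integral_smul]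
  refine integral_congr_ae (.of_forall fun x => ?_)
  simp only [smul_smul, likelihood, div_eq_inv_mul]

/-- Trades growth in `x` for growth in `y - x`, the variable in which the likelihood decays. -/
lemma norm_le_of_sub (y x : Space d) : 1 + ‖x‖ ≤ (1 + ‖y‖) * (1 + ‖y - x‖) := by
  have : ‖x‖ ≤ ‖y‖ + ‖y - x‖ := by
    have := norm_sub_le y (y - x)
    simpa using this
  nlinarith [norm_nonneg y, norm_nonneg (y - x)]

lemma hasFDerivAt_likelihood (hσ : 0 < σ) (y x : Space d) :
    HasFDerivAt (fun y => likelihood σ y x)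
      (likelihood σ y x • (σ ^ 2)⁻¹ • innerSL ℝ (x - y)) y := by
  have h := ((hasStrictFDerivAt_norm_sq (y - x)).hasFDerivAt.comp y
    ((hasFDerivAt_id y).sub_const x)).const_mul (-(2 * σ ^ 2)⁻¹)
  have h2 := h.exp
  refine (h2.congr_fderiv ?_).congr_of_eventuallyEq (.of_forall fun z => ?_)
  · ext v
    simp [likelihood]
    rw [show -((σ ^ 2)⁻¹ * 2⁻¹ * ‖y - x‖ ^ 2) = -‖y - x‖ ^ 2 / (2 * σ ^ 2) by field_simp]
    ring
  · simp only [likelihood, Function.comp, id]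
    congr 1
    field_simp

/-- The derivative in `y` of `likelihood σ y x • v`. -/
noncomputable def likelihoodFDeriv (σ : ℝ) (y x : Space d) (v : E) : Space d →L[ℝ] E :=
  (likelihood σ y x • (σ ^ 2)⁻¹ • innerSL ℝ (x - y)).smulRight v

lemma likelihoodFDeriv_apply (y x : Space d) (v : E) (u : Space d) :
    likelihoodFDeriv σ y x v u = likelihood σ y x • ((σ ^ 2)⁻¹ * inner ℝ (x - y) u) • v := by
  simp [likelihoodFDeriv, smul_smul, mul_assoc, inner_sub_left]

lemma norm_likelihoodFDeriv_le (hσ : 0 < σ) (y x : Space d) {v : E} (hv : ‖v‖ ≤ 1 + ‖x‖) :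
    ‖likelihoodFDeriv σ y x v‖ ≤ ((σ ^ 2)⁻¹ * (1 + ‖y‖)) * (2 * (1 + 2 * σ ^ 2)) := by
  have e : ‖likelihoodFDeriv σ y x v‖ = ‖likelihood σ y x • ((σ ^ 2)⁻¹ * ‖y - x‖ * ‖v‖)‖ := by
    rw [likelihoodFDeriv, ContinuousLinearMap.norm_smulRight_apply, norm_smul, norm_smul, norm_smul,
      innerSL_apply_norm, Real.norm_of_nonneg (by positivity : 0 ≤ (σ ^ 2)⁻¹ * ‖y - x‖ * ‖v‖),
      norm_inv, Real.norm_of_nonneg (sq_nonneg σ), norm_sub_rev]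
    ring
  rw [e]
  refine norm_likelihood_smul_le hσ ?_
  rw [Real.norm_of_nonneg (by positivity)]
  calc (σ ^ 2)⁻¹ * ‖y - x‖ * ‖v‖
      ≤ (σ ^ 2)⁻¹ * (1 + ‖y - x‖) * ((1 + ‖y‖) * (1 + ‖y - x‖)) := by
        gcongr
        · linarith
        · exact hv.trans (norm_le_of_sub y x)
    _ = _ := by ring

lemma continuous_likelihoodFDeriv (y : Space d) {g : Space d → E} (hg : Continuous g) :
    Continuous fun x => likelihoodFDeriv σ y x (g x) := by
  have h1 := (continuous_likelihood σ).comp (Continuous.prodMk_right y)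
  have h2 : Continuous fun x => likelihood σ y x • (σ ^ 2)⁻¹ • innerSL ℝ (x - y) :=
    h1.smul (by fun_prop)
  exact ((ContinuousLinearMap.smulRightL ℝ (Space d) E).continuous.comp h2).clm_apply hg

lemma integrable_likelihoodFDeriv (hσ : 0 < σ) (y : Space d) {g : Space d → E}
    (hg : Continuous g) (hb : ∀ x, ‖g x‖ ≤ 1 + ‖x‖) :
    Integrable (fun x => likelihoodFDeriv σ y x (g x)) pd :=
  Integrable.of_bound (continuous_likelihoodFDeriv y hg).aestronglyMeasurable _
    (.of_forall fun x => norm_likelihoodFDeriv_le hσ y x (hb x))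

lemma hasFDerivAt_integral_likelihood_smul (hσ : 0 < σ) (y : Space d) {g : Space d → E}
    (hg : Continuous g) (hb : ∀ x, ‖g x‖ ≤ 1 + ‖x‖) :
    HasFDerivAt (fun y => ∫ x, likelihood σ y x • g x ∂pd)
      (∫ x, likelihoodFDeriv σ y x (g x) ∂pd) y := by
  have hg2 : ∀ y x, ‖g x‖ ≤ (1 + ‖y‖) * (1 + ‖y - x‖) ^ 2 := fun y x => by
    refine ((hb x).trans (norm_le_of_sub y x)).trans ?_
    have : (1 + ‖y - x‖) ≤ (1 + ‖y - x‖) ^ 2 := by nlinarith [norm_nonneg (y - x)]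
    gcongr
  refine hasFDerivAt_integral_of_dominated_of_fderiv_le (s := Metric.ball y 1)
    -- On the unit ball around `y` one has `1 + ‖z‖ ≤ 2 + ‖y‖`, so a constant dominates, and
    -- constants are integrable for the probability measure `pd`.
    (bound := fun _ => ((σ ^ 2)⁻¹ * (2 + ‖y‖)) * (2 * (1 + 2 * σ ^ 2)))
    (Metric.ball_mem_nhds y one_pos) (.of_forall fun z =>
      (integrable_likelihood_smul hσ z hg (hg2 z)).aestronglyMeasurable)
    (integrable_likelihood_smul hσ y hg (hg2 y))
    (continuous_likelihoodFDeriv y hg).aestronglyMeasurable (.of_forall fun x z hz => ?_)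
    (integrable_const _)
    (.of_forall fun x z hz => (hasFDerivAt_likelihood hσ z x).smul_const (g x))
  refine (norm_likelihoodFDeriv_le hσ z x (hb x)).trans ?_
  have hz' : ‖z‖ ≤ 1 + ‖y‖ := by
    have := norm_le_norm_add_norm_sub' z y
    rw [mem_ball_iff_norm] at hz
    linarith
  have : 1 + ‖z‖ ≤ 2 + ‖y‖ := by linarith
  gcongr

end Posterior

/-! ### Mean and covariance of the posterior. -/

section Moments

variable {pd : Measure (Space d)} [IsProbabilityMeasure pd] {σ : ℝ}

lemma abs_coord_le (y x : Space d) (i : Fin d) : |x i| ≤ (1 + ‖y‖) * (1 + ‖y - x‖) :=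
  ((PiLp.norm_apply_le x i).trans (by linarith)).trans (norm_le_of_sub y x)

lemma memLp_coord_truePosterior (hσ : 0 < σ) (y : Space d) (i : Fin d) :
    MemLp (fun x : Space d => x i) 2 (truePosterior pd σ y) := by
  rw [memLp_two_iff_integrable_sq (by fun_prop)]
  refine integrable_truePosterior hσ y (by fun_prop) (c := (1 + ‖y‖) ^ 2) fun x => ?_
  rw [Real.norm_of_nonneg (sq_nonneg _), ← sq_abs, ← mul_pow]
  exact pow_le_pow_left₀ (abs_nonneg _) (abs_coord_le y x i) 2

lemma integrable_id_truePosterior (hσ : 0 < σ) (y : Space d) :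
    Integrable (fun x : Space d => x) (truePosterior pd σ y) := by
  refine integrable_truePosterior hσ y continuous_id (c := 1 + ‖y‖) fun x => ?_
  have h : (1 + ‖y - x‖) ≤ (1 + ‖y - x‖) ^ 2 := by nlinarith [norm_nonneg (y - x)]
  calc ‖x‖ ≤ (1 + ‖y‖) * (1 + ‖y - x‖) := by linarith [norm_le_of_sub y x]
    _ ≤ _ := by gcongr

lemma posteriorMean_apply (hσ : 0 < σ) (y : Space d) (i : Fin d) :
    ∫ x, x i ∂(truePosterior pd σ y) = posteriorMean pd σ y i := by
  have := (EuclideanSpace.proj (𝕜 := ℝ) i).integral_comp_comm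
    (integrable_id_truePosterior (pd := pd) hσ y)
  exact this

/-- The directional derivative of the posterior mean is a posterior covariance. -/
lemma hasFDerivAt_posteriorMean (hσ : 0 < σ) (y : Space d) :
    ∃ L : Space d →L[ℝ] Space d, HasFDerivAt (posteriorMean pd σ) L y ∧
      ∀ v i, L v i = (σ ^ 2)⁻¹ * (∫ x, inner ℝ (x - y) v * x i ∂(truePosterior pd σ y) -
        (∫ x, inner ℝ (x - y) v ∂(truePosterior pd σ y)) * posteriorMean pd σ y i) := by
  have hN := hasFDerivAt_integral_likelihood_smul (pd := pd) hσ y (g := fun x => x)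
    continuous_id (fun x => by linarith)
  have hZ := hasFDerivAt_integral_likelihood_smul (pd := pd) hσ y (g := fun _ => (1 : ℝ))
    continuous_const (fun x => by rw [norm_one]; linarith [norm_nonneg x])
  have hNi := integrable_likelihoodFDeriv (pd := pd) hσ y (g := fun x => x)
    continuous_id (fun x => by linarith)
  have hZi := integrable_likelihoodFDeriv (pd := pd) hσ y (g := fun _ => (1 : ℝ))
    continuous_const (fun x => by rw [norm_one]; linarith [norm_nonneg x])
  simp only [smul_eq_mul, mul_one] at hZ
  have hZ0 := (integral_likelihood_pos (pd := pd) hσ y).ne'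
  -- The posterior mean is the quotient of `∫ ℓ x` by `∫ ℓ`, with `ℓ` the likelihood. The derivative
  -- of the denominator produces the subtracted product of means.
  have h := ((hasDerivAt_inv hZ0).comp_hasFDerivAt y hZ).smul hN
  refine ⟨_, h.congr_of_eventuallyEq (.of_forall fun z => integral_truePosterior z _),
    fun v i => ?_⟩
  have e1 : (∫ x, likelihoodFDeriv σ y x x ∂pd) v i =
      (σ ^ 2)⁻¹ * ∫ x, likelihood σ y x • (inner ℝ (x - y) v * x i) ∂pd := by
    rw [ContinuousLinearMap.integral_apply hNi]
    have h1 := (EuclideanSpace.proj (𝕜 := ℝ) i).integral_comp_comm (hNi.apply_continuousLinearMap v)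
    rw [show ∀ u : Space d, u i = EuclideanSpace.proj (𝕜 := ℝ) i u from fun _ => rfl, ← h1,
      ← integral_const_mul]
    refine integral_congr_ae (.of_forall fun x => ?_)
    simp [likelihoodFDeriv_apply]
    ring
  have e2 : (∫ x, likelihoodFDeriv σ y x (1 : ℝ) ∂pd) v =
      (σ ^ 2)⁻¹ * ∫ x, likelihood σ y x • inner ℝ (x - y) v ∂pd := by
    rw [ContinuousLinearMap.integral_apply hZi, ← integral_const_mul]
    refine integral_congr_ae (.of_forall fun x => ?_)
    simp [likelihoodFDeriv_apply]
    ring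
  have e3 : posteriorMean pd σ y i = (∫ x, likelihood σ y x ∂pd)⁻¹ *
      (∫ x, likelihood σ y x • x ∂pd) i := by
    rw [posteriorMean, integral_truePosterior]; rfl
  rw [integral_truePosterior, integral_truePosterior, e3]
  simp only [add_apply, smul_apply,
    ContinuousLinearMap.smulRight_apply, PiLp.add_apply, PiLp.smul_apply, e1, e2, smul_eq_mul,
    Function.comp]
  ring

lemma differentiable_posteriorMean (hσ : 0 < σ) : Differentiable ℝ (posteriorMean pd σ) :=
  fun y => let ⟨_, hL, _⟩ := hasFDerivAt_posteriorMean hσ y; hL.differentiableAt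

/-- The derivative in direction `j` is `σ⁻²` times the covariance of `x j - y j` with `x i`, and the
constant shift by `y j` does not affect a covariance. -/
lemma hasMoments_truePosterior (hσ : 0 < σ) (y : Space d) :
    HasMoments (truePosterior pd σ y) (posteriorMean pd σ y)
      (σ ^ 2 • jacobian (posteriorMean pd σ) y) := by
  have := isProbabilityMeasure_truePosterior (pd := pd) hσ y
  have hm := posteriorMean_apply (pd := pd) hσ y
  have hL2 := memLp_coord_truePosterior (pd := pd) hσ y
  refine ⟨hL2, hm, fun i j => ?_⟩
  obtain ⟨L, hL, hLv⟩ := hasFDerivAt_posteriorMean (pd := pd) hσ y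
  rw [Matrix.smul_apply, jacobian, Matrix.of_apply, hL.fderiv, hLv, smul_eq_mul,
    mul_inv_cancel_left₀ (by positivity)]
  have hi := fun i => (hL2 i).integrable (q := 2) (by norm_num)
  have hij : Integrable (fun x : Space d => x i * x j) (truePosterior pd σ y) :=
    (hL2 i).integrable_mul (hL2 j)
  have hc := covariance_eq_sub (hL2 i) (hL2 j)
  simp only [covariance, hm, Pi.mul_apply] at hc
  rw [hc]
  have e1 : ∀ x : Space d, inner ℝ (x - y) (EuclideanSpace.single j (1 : ℝ)) = x j - y j :=
    fun x => by simp [EuclideanSpace.inner_single_right]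
  simp_rw [e1, sub_mul, mul_comm _ ((_ : Space d) i)]
  rw [integral_sub hij ((hi i).mul_const _), integral_sub (hi j) (integrable_const _),
    integral_mul_const, hm, hm]
  simp
  ring

omit [IsProbabilityMeasure pd] in
lemma truePosterior_absolutelyContinuous (y : Space d) : truePosterior pd σ y ≪ pd :=
  tilted_absolutelyContinuous _ _

lemma posDef_smul_jacobian (hσ : 0 < σ) (hpd : pd ≪ volume) (y : Space d) :
    (σ ^ 2 • jacobian (posteriorMean pd σ) y).PosDef :=
  have := isProbabilityMeasure_truePosterior (pd := pd) hσ y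
  (hasMoments_truePosterior hσ y).posDef ((truePosterior_absolutelyContinuous y).trans hpd)

end Moments

lemma measurable_likelihood {d : ℕ} (σ : ℝ) :
    Measurable fun p : Space d × Space d => likelihood σ p.1 p.2 :=
  (continuous_likelihood σ).measurable

/-! ### Divergence of two joint laws with a common marginal. -/

section Disintegration

variable {α β : Type*} [MeasurableSpace α] [MeasurableSpace β]
  [MeasurableSpace.CountableOrCountablyGenerated α β] {μ : Measure α} [IsFiniteMeasure μ]
  {κ η : Kernel α β} [IsFiniteKernel κ] [IsFiniteKernel η]

lemma rnDeriv_compProd_right (h : ∀ᵐ a ∂μ, κ a ≪ η a) :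
    (μ ⊗ₘ κ).rnDeriv (μ ⊗ₘ η) =ᵐ[μ ⊗ₘ η] fun p => κ.rnDeriv η p.1 p.2 := by
  have e : μ ⊗ₘ κ = (μ ⊗ₘ η).withDensity fun p => κ.rnDeriv η p.1 p.2 := by
    rw [← Measure.compProd_withDensity (κ.measurable_rnDeriv η)]
    refine Measure.compProd_congr ?_
    filter_upwards [h] with a ha using (Kernel.withDensity_rnDeriv_eq ha).symm
  rw [e]
  exact Measure.rnDeriv_withDensity _ (κ.measurable_rnDeriv η)

lemma klDiv_eq_lintegral_kernel_rnDeriv {a : α} (h : κ a ≪ η a) :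
    InformationTheory.klDiv (κ a) (η a) =
      ∫⁻ b, ENNReal.ofReal (InformationTheory.klFun (κ.rnDeriv η a b).toReal) ∂(η a) := by
  rw [InformationTheory.klDiv_eq_lintegral_klFun_of_ac h]
  refine lintegral_congr_ae ?_
  filter_upwards [κ.rnDeriv_eq_rnDeriv_measure (η := η) (a := a)] with b hb
  rw [hb]

omit [IsFiniteKernel κ] [IsFiniteKernel η] in
lemma measurable_ofReal_klFun_rnDeriv : Measurable fun p : α × β =>
    ENNReal.ofReal (InformationTheory.klFun (κ.rnDeriv η p.1 p.2).toReal) := by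
  have := κ.measurable_rnDeriv η
  fun_prop

omit [IsFiniteMeasure μ] in
lemma aemeasurable_klDiv_kernel (h : ∀ᵐ a ∂μ, κ a ≪ η a) :
    AEMeasurable (fun a => InformationTheory.klDiv (κ a) (η a)) μ := by
  refine ⟨_, (measurable_ofReal_klFun_rnDeriv (κ := κ) (η := η)).lintegral_kernel_prod_right'
    (κ := η), ?_⟩
  filter_upwards [h] with a ha using klDiv_eq_lintegral_kernel_rnDeriv ha

/-- The joint density ratio is the fibrewise one. Writing the divergence as a `lintegral` of the
nonnegative `klFun` lets it be integrated fibre by fibre with values in `[0, ∞]`, without a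
finiteness assumption. -/
lemma klDiv_compProd_right (h : ∀ᵐ a ∂μ, κ a ≪ η a) :
    InformationTheory.klDiv (μ ⊗ₘ κ) (μ ⊗ₘ η) =
      ∫⁻ a, InformationTheory.klDiv (κ a) (η a) ∂μ := by
  rw [InformationTheory.klDiv_eq_lintegral_klFun_of_ac
    (Measure.AbsolutelyContinuous.compProd_right h)]
  have : ∀ᵐ p ∂(μ ⊗ₘ η),
      ENNReal.ofReal (InformationTheory.klFun ((μ ⊗ₘ κ).rnDeriv (μ ⊗ₘ η) p).toReal) =
        ENNReal.ofReal (InformationTheory.klFun (κ.rnDeriv η p.1 p.2).toReal) := by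
    filter_upwards [rnDeriv_compProd_right h] with p hp
    rw [hp]
  rw [lintegral_congr_ae this, Measure.lintegral_compProd measurable_ofReal_klFun_rnDeriv]
  refine lintegral_congr_ae ?_
  filter_upwards [h] with a ha using (klDiv_eq_lintegral_kernel_rnDeriv ha).symm

end Disintegration

/-! ### Bayes' rule. -/

/-- The posterior as a kernel. -/
noncomputable def posteriorKernel (pd : Measure (Space d)) [IsProbabilityMeasure pd] (σ : ℝ) :
    Kernel (Space d) (Space d) where
  toFun := truePosterior pd σ
  measurable' := by
    refine Measure.measurable_of_measurable_coe _ fun s hs => ?_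
    simp_rw [truePosterior, tilted_apply' _ _ hs]
    have h1 := (measurable_likelihood (d := d) σ)
    have h2 : Measurable fun y : Space d => ∫ x, likelihood σ y x ∂pd :=
      (h1.stronglyMeasurable.integral_prod_right (ν := pd)).measurable
    have h3 : Measurable fun p : Space d × Space d =>
        ENNReal.ofReal (likelihood σ p.1 p.2 / ∫ x, likelihood σ p.1 x ∂pd) :=
      (h1.div (h2.comp measurable_fst)).ennreal_ofReal
    exact h3.lintegral_prod_right' (ν := pd.restrict s)

lemma posteriorKernel_apply (pd : Measure (Space d)) [IsProbabilityMeasure pd] (σ : ℝ)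
    (y : Space d) : posteriorKernel pd σ y = truePosterior pd σ y := rfl

lemma isMarkovKernel_posteriorKernel {pd : Measure (Space d)} [IsProbabilityMeasure pd] {σ : ℝ}
    (hσ : 0 < σ) : IsMarkovKernel (posteriorKernel pd σ) :=
  ⟨fun y => isProbabilityMeasure_truePosterior hσ y⟩

lemma noise_apply_eq_withDensity {σ : ℝ} (hσ : 0 < σ) (x : Space d) :
    noise d σ x = volume.withDensity fun y =>
      ENNReal.ofReal (likelihood σ y x / ∫ z : Space d, likelihood σ z 0) := by
  have hS : (σ ^ 2 • (1 : Matrix (Fin d) (Fin d) ℝ)).PosDef :=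
    Matrix.PosDef.one.smul (by positivity)
  have hinv : (σ ^ 2 • (1 : Matrix (Fin d) (Fin d) ℝ))⁻¹ = (σ ^ 2)⁻¹ • 1 := by
    refine Matrix.inv_eq_left_inv ?_
    rw [smul_mul_smul_comm, inv_mul_cancel₀ (by positivity), one_smul, one_mul]
  have he : ∀ y, Real.exp (gaussianExponent x (σ ^ 2 • (1 : Matrix (Fin d) (Fin d) ℝ))⁻¹ y) =
      likelihood σ y x := fun y => by
    have h2 : (y - x).ofLp ⬝ᵥ (y - x).ofLp = ‖y - x‖ ^ 2 := by
      rw [EuclideanSpace.real_norm_sq_eq, dotProduct]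
      simp [sq]
    rw [likelihood, gaussianExponent, hinv, Matrix.smul_mulVec, Matrix.one_mulVec, dotProduct_smul,
      h2, smul_eq_mul]
    congr 1
    field_simp
  -- By translation invariance the normaliser does not depend on `x`, so it can cancel in Bayes'
  -- rule.
  have hc : ∫ z : Space d, likelihood σ z x = ∫ z : Space d, likelihood σ z 0 := by
    rw [← integral_sub_right_eq_self (fun z => likelihood σ z (0 : Space d)) x]
    simp [likelihood]
  change multivariateGaussian x _ = _
  rw [multivariateGaussian_eq_tilted x hS, Measure.tilted]
  simp_rw [he, hc]

section Bayes

variable {pd : Measure (Space d)} [IsProbabilityMeasure pd] {σ : ℝ}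

lemma lintegral_noise (hσ : 0 < σ) {F : Space d × Space d → ℝ≥0∞} (hF : Measurable F) :
    ∫⁻ x, ∫⁻ y, F (y, x) ∂(noise d σ x) ∂pd =
      ∫⁻ y, ∫⁻ x,
        ENNReal.ofReal (likelihood σ y x / ∫ z : Space d, likelihood σ z 0) * F (y, x) ∂pd := by
  have hm : Measurable fun p : Space d × Space d =>
      ENNReal.ofReal (likelihood σ p.1 p.2 / ∫ z : Space d, likelihood σ z 0) :=
    ((measurable_likelihood σ).div_const _).ennreal_ofReal
  rw [lintegral_lintegral_swap ((hm.mul hF).aemeasurable)]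
  refine lintegral_congr fun x => ?_
  rw [noise_apply_eq_withDensity hσ]
  exact lintegral_withDensity_eq_lintegral_mul _ (hm.comp measurable_prodMk_right)
    (hF.comp measurable_prodMk_right)

lemma lintegral_noisedData (hσ : 0 < σ) {g : Space d → ℝ≥0∞} (hg : Measurable g) :
    ∫⁻ y, g y ∂(noisedData pd σ) =
      ∫⁻ y,
        ENNReal.ofReal ((∫ x, likelihood σ y x ∂pd) / ∫ z : Space d, likelihood σ z 0) * g y := by
  rw [noisedData, Measure.lintegral_bind (noise d σ).measurable.aemeasurable hg.aemeasurable,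
    lintegral_noise (F := fun p => g p.1) hσ (hg.comp measurable_fst)]
  refine lintegral_congr fun y => ?_
  have hm : Measurable fun x : Space d =>
      ENNReal.ofReal (likelihood σ y x / ∫ z : Space d, likelihood σ z 0) :=
    (((measurable_likelihood σ).comp measurable_prodMk_left).div_const _).ennreal_ofReal
  dsimp only
  rw [lintegral_mul_const _ hm, ← integral_div, ofReal_integral_eq_lintegral_ofReal
    ((integrable_likelihood hσ y).div_const _)]
  refine .of_forall fun x => div_nonneg (likelihood_pos σ y x).le ?_
  exact integral_nonneg fun z => (likelihood_pos σ z 0).le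

/-- Bayes' rule: the true joint law disintegrates along the posterior. -/
lemma trueJoint_eq_compProd (hσ : 0 < σ) :
    trueJoint pd σ = noisedData pd σ ⊗ₘ posteriorKernel pd σ := by
  have := isMarkovKernel_posteriorKernel (pd := pd) hσ
  have : IsProbabilityMeasure (noisedData pd σ) := by unfold noisedData; infer_instance
  ext s hs
  rw [trueJoint, Measure.map_apply measurable_swap hs,
    Measure.compProd_apply (measurable_swap hs), Measure.compProd_apply hs,
    lintegral_noisedData hσ (Kernel.measurable_kernel_prodMk_left hs)]
  have h1 : ∀ x : Space d, noise d σ x (Prod.mk x ⁻¹' (Prod.swap ⁻¹' s)) =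
      ∫⁻ y, s.indicator 1 (y, x) ∂(noise d σ x) := fun x => by
    rw [← lintegral_indicator_one (measurable_prodMk_left (measurable_swap hs))]
    rfl
  simp_rw [h1]
  rw [lintegral_noise (F := s.indicator 1) hσ (measurable_one.indicator hs)]
  refine lintegral_congr fun y => ?_
  rw [posteriorKernel_apply, ← lintegral_indicator_one (measurable_prodMk_left hs), truePosterior,
    lintegral_tilted, ← lintegral_const_mul' _ _ ENNReal.ofReal_ne_top]
  refine lintegral_congr fun x => ?_
  have hZ := integral_likelihood_pos (pd := pd) hσ y
  have hC : 0 ≤ ∫ z : Space d, likelihood σ z 0 :=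
    integral_nonneg fun z => (likelihood_pos σ z 0).le
  rw [← mul_assoc, ← ENNReal.ofReal_mul (by positivity)]
  change _ * s.indicator 1 (y, x) = _ * s.indicator 1 (y, x)
  congr 2
  -- With `C` the noise normaliser and `Z` the evidence integral, this is `ℓ / C = (Z / C) * (ℓ /
  -- Z)`; only `Z` has to be nonzero.
  change likelihood σ y x / _ = _ * (likelihood σ y x / ∫ x, likelihood σ y x ∂pd)
  field_simp

end Bayes

/-! ### Gaussian conditionals as kernels. -/

open scoped MatrixOrder Matrix.Norms.L2Operator in
/-- The Gaussian conditional with measurable parameters. -/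
noncomputable def gaussianKernel {m : Space d → Space d} {S : Space d → Matrix (Fin d) (Fin d) ℝ}
    (hm : Measurable m) (hS : ∀ i j, Measurable fun y => S y i j) (hpsd : ∀ y, (S y).PosSemidef) :
    Kernel (Space d) (Space d) where
  toFun y := multivariateGaussian (m y) (S y)
  measurable' := by
    refine Measure.measurable_of_measurable_coe _ fun s hs => ?_
    let : MeasurableSpace (Matrix (Fin d) (Fin d) ℝ) := MeasurableSpace.pi
    have : BorelSpace (Matrix (Fin d) (Fin d) ℝ) :=
      inferInstanceAs (BorelSpace (Fin d → Fin d → ℝ))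
    -- Continuity of the matrix square root is used on the positive semidefinite cone, so `S` is
    -- first viewed as a map into that subtype.
    have hS' : Measurable fun y => (⟨S y, (hpsd y).nonneg⟩ :
        {a : Matrix (Fin d) (Fin d) ℝ | 0 ≤ a}) :=
      Measurable.subtype_mk (measurable_pi_lambda _ fun i => measurable_pi_lambda _ fun j => hS i j)
    have hc : Continuous fun a : {a : Matrix (Fin d) (Fin d) ℝ | 0 ≤ a} =>
        CFC.sqrt (a : Matrix (Fin d) (Fin d) ℝ) :=
      continuousOn_iff_continuous_domRestrict.1 CFC.continuousOn_sqrt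
    have hR : ∀ i j, Measurable fun y => CFC.sqrt (S y) i j := fun i j => by
      have : Continuous fun a : {a : Matrix (Fin d) (Fin d) ℝ | 0 ≤ a} =>
          CFC.sqrt (a : Matrix (Fin d) (Fin d) ℝ) i j := hc.matrix_elem i j
      exact this.measurable.comp hS'
    have h : Measurable fun p : Space d × Space d =>
        m p.1 + Matrix.toEuclideanCLM (𝕜 := ℝ) (CFC.sqrt (S p.1)) p.2 := by
      refine (hm.comp measurable_fst).add ?_
      refine (WithLp.measurable_toLp 2 (Fin d → ℝ)).comp
        (measurable_pi_lambda (fun p : Space d × Space d =>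
          (CFC.sqrt (S p.1)).mulVec p.2.ofLp) fun i => ?_)
      simp only [Matrix.mulVec, dotProduct]
      exact Finset.measurable_sum _ fun j _ => ((hR i j).comp measurable_fst).mul (by fun_prop)
    have e : (fun y => multivariateGaussian (m y) (S y) s) =
        fun y => stdGaussian (Space d) (Prod.mk y ⁻¹' ((fun p : Space d × Space d =>
          m p.1 + Matrix.toEuclideanCLM (𝕜 := ℝ) (CFC.sqrt (S p.1)) p.2) ⁻¹' s)) := by
      funext x
      exact Measure.map_apply (by fun_prop) hs
    rw [e]
    exact measurable_measure_prodMk_left (h hs)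

/-! ### Optimality and uniqueness. -/

lemma HasGaussianParams.isMarkovKernel {q : Kernel (Space d) (Space d)} {m : Space d → Space d}
    {S : Space d → Matrix (Fin d) (Fin d) ℝ} (h : HasGaussianParams q m S) : IsMarkovKernel q :=
  ⟨fun y => by rw [(h y).2]; infer_instance⟩

instance isProbabilityMeasure_noisedData (pd : Measure (Space d)) [IsProbabilityMeasure pd]
    (σ : ℝ) : IsProbabilityMeasure (noisedData pd σ) := by
  unfold noisedData; infer_instance

variable {pd : Measure (Space d)} [IsProbabilityMeasure pd] {σ : ℝ}

lemma truePosterior_absolutelyContinuous_of_jointKL_ne_top (hσ : 0 < σ)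
    {q : Kernel (Space d) (Space d)} [IsMarkovKernel q] (h : jointKL pd σ q ≠ ∞) :
    ∀ᵐ y ∂(noisedData pd σ), truePosterior pd σ y ≪ q y := by
  have := isMarkovKernel_posteriorKernel (pd := pd) hσ
  rw [jointKL, trueJoint_eq_compProd hσ, modelJoint, InformationTheory.klDiv_ne_top_iff] at h
  exact Measure.absolutelyContinuous_compProd_right_iff.1 h.1

lemma jointKL_eq_lintegral (hσ : 0 < σ) {q : Kernel (Space d) (Space d)} [IsMarkovKernel q]
    (h : ∀ᵐ y ∂(noisedData pd σ), truePosterior pd σ y ≪ q y) :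
    jointKL pd σ q =
      ∫⁻ y, InformationTheory.klDiv (truePosterior pd σ y) (q y) ∂(noisedData pd σ) := by
  have := isMarkovKernel_posteriorKernel (pd := pd) hσ
  rw [jointKL, trueJoint_eq_compProd hσ, modelJoint]
  exact klDiv_compProd_right h

lemma aemeasurable_klDiv_truePosterior (hσ : 0 < σ) {q : Kernel (Space d) (Space d)}
    [IsMarkovKernel q] (h : ∀ᵐ y ∂(noisedData pd σ), truePosterior pd σ y ≪ q y) :
    AEMeasurable (fun y => InformationTheory.klDiv (truePosterior pd σ y) (q y))
      (noisedData pd σ) :=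
  have := isMarkovKernel_posteriorKernel (pd := pd) hσ
  aemeasurable_klDiv_kernel (κ := posteriorKernel pd σ) h

omit [IsProbabilityMeasure pd] in
lemma jointKL_congr {q q' : Kernel (Space d) (Space d)} [IsMarkovKernel q] [IsMarkovKernel q']
    (h : ∀ᵐ y ∂(noisedData pd σ), q y = q' y) : jointKL pd σ q = jointKL pd σ q' := by
  rw [jointKL, jointKL, modelJoint, modelJoint, Measure.compProd_congr h]

/-- The Gaussian conditional that matches the first two moments of the true posterior. -/
noncomputable def momentMatchedKernel (pd : Measure (Space d)) [IsProbabilityMeasure pd] {σ : ℝ}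
    (hσ : 0 < σ) (hpd : pd ≪ volume) : Kernel (Space d) (Space d) :=
  gaussianKernel (m := posteriorMean pd σ)
    (S := fun y => σ ^ 2 • jacobian (posteriorMean pd σ) y)
    (differentiable_posteriorMean hσ).continuous.measurable
    (fun i j => by
      simp only [Matrix.smul_apply, jacobian, Matrix.of_apply]
      have := measurable_fderiv_apply_const ℝ (posteriorMean pd σ)
        (EuclideanSpace.single j (1 : ℝ))
      fun_prop)
    (fun y => (posDef_smul_jacobian hσ hpd y).posSemidef)

section

variable (hσ : 0 < σ) (hpd : pd ≪ volume)

lemma hasGaussianParams_momentMatchedKernel :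
    HasGaussianParams (momentMatchedKernel pd hσ hpd) (posteriorMean pd σ)
      (fun y => σ ^ 2 • jacobian (posteriorMean pd σ) y) :=
  fun y => ⟨(posDef_smul_jacobian hσ hpd y).posSemidef, rfl⟩

lemma truePosterior_absolutelyContinuous_momentMatchedKernel (y : Space d) :
    truePosterior pd σ y ≪ momentMatchedKernel pd hσ hpd y :=
  ((truePosterior_absolutelyContinuous y).trans hpd).trans
    (volume_absolutelyContinuous_multivariateGaussian _ (posDef_smul_jacobian hσ hpd y))

/-- The Pythagorean identity on one fibre. The hypothesis `hac` rules out singular `S`, so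
semidefiniteness suffices. -/
lemma klDiv_truePosterior_eq_add {m : Space d} {S : Matrix (Fin d) (Fin d) ℝ} (y : Space d)
    (hS : S.PosSemidef) (hac : truePosterior pd σ y ≪ multivariateGaussian m S) :
    InformationTheory.klDiv (truePosterior pd σ y) (multivariateGaussian m S) =
      InformationTheory.klDiv (truePosterior pd σ y) (momentMatchedKernel pd hσ hpd y) +
        InformationTheory.klDiv (momentMatchedKernel pd hσ hpd y) (multivariateGaussian m S) := by
  have := isProbabilityMeasure_truePosterior (pd := pd) hσ y
  have hv : truePosterior pd σ y ≪ volume := (truePosterior_absolutelyContinuous y).trans hpd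
  by_cases hS' : S.PosDef
  · exact klDiv_multivariateGaussian_eq_add hv (hasMoments_truePosterior hσ y)
      (posDef_smul_jacobian hσ hpd y) m hS'
  · exact absurd hac (not_absolutelyContinuous_multivariateGaussian hv m hS hS')

lemma isMinOn_momentMatchedKernel :
    IsMinOn (jointKL pd σ) (gaussianConditionals d) (momentMatchedKernel pd hσ hpd) := by
  rintro q ⟨m, S, hq⟩
  have := hq.isMarkovKernel
  have := (hasGaussianParams_momentMatchedKernel hσ hpd).isMarkovKernel
  change jointKL pd σ (momentMatchedKernel pd hσ hpd) ≤ jointKL pd σ q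
  -- A finite value supplies the fibrewise absolute continuity that the integral formula needs.
  by_cases hfin : jointKL pd σ q = ∞
  · rw [hfin]; exact le_top
  have hac := truePosterior_absolutelyContinuous_of_jointKL_ne_top hσ hfin
  rw [jointKL_eq_lintegral hσ hac, jointKL_eq_lintegral hσ
    (.of_forall (truePosterior_absolutelyContinuous_momentMatchedKernel hσ hpd))]
  refine lintegral_mono_ae ?_
  filter_upwards [hac] with y hy
  rw [(hq y).2] at hy ⊢
  rw [klDiv_truePosterior_eq_add hσ hpd y (hq y).1 hy]
  exact le_self_add

/-- The fibrewise divergences are ordered and the optimal one has finite integral, so the reverse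
inequality of integrals makes them equal almost everywhere. The excess divergence between the two
Gaussians is then zero. -/
lemma ae_eq_of_jointKL_le {q : Kernel (Space d) (Space d)} {m : Space d → Space d}
    {S : Space d → Matrix (Fin d) (Fin d) ℝ} (hq : HasGaussianParams q m S)
    (hfin : jointKL pd σ q ≠ ∞)
    (hle : jointKL pd σ q ≤ jointKL pd σ (momentMatchedKernel pd hσ hpd)) :
    ∀ᵐ y ∂(noisedData pd σ), m y = posteriorMean pd σ y ∧
      S y = σ ^ 2 • jacobian (posteriorMean pd σ) y := by
  have := hq.isMarkovKernel
  have hopt := hasGaussianParams_momentMatchedKernel (pd := pd) hσ hpd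
  have := hopt.isMarkovKernel
  have hac := truePosterior_absolutelyContinuous_of_jointKL_ne_top hσ hfin
  have hac' : ∀ᵐ y ∂(noisedData pd σ), truePosterior pd σ y ≪ momentMatchedKernel pd hσ hpd y :=
    .of_forall (truePosterior_absolutelyContinuous_momentMatchedKernel hσ hpd)
  have hfin' : jointKL pd σ (momentMatchedKernel pd hσ hpd) ≠ ∞ :=
    ne_top_of_le_ne_top hfin (isMinOn_momentMatchedKernel hσ hpd ⟨m, S, hq⟩)
  rw [jointKL_eq_lintegral hσ hac, jointKL_eq_lintegral hσ hac'] at hle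
  rw [jointKL_eq_lintegral hσ hac'] at hfin'
  have hmono : (fun y => InformationTheory.klDiv (truePosterior pd σ y)
      (momentMatchedKernel pd hσ hpd y)) ≤ᵐ[noisedData pd σ]
      fun y => InformationTheory.klDiv (truePosterior pd σ y) (q y) := by
    filter_upwards [hac] with y hy
    rw [(hq y).2] at hy ⊢
    rw [klDiv_truePosterior_eq_add hσ hpd y (hq y).1 hy]
    exact le_self_add
  have heq := ae_eq_of_ae_le_of_lintegral_le hmono hfin'
    (aemeasurable_klDiv_truePosterior hσ hac) hle
  have hlt := ae_lt_top' (aemeasurable_klDiv_truePosterior hσ hac') hfin'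
  filter_upwards [hac, heq, hlt] with y hy he hl
  rw [(hq y).2] at hy he
  rw [klDiv_truePosterior_eq_add hσ hpd y (hq y).1 hy] at he
  -- Cancellation in `[0, ∞]` requires the common term to be finite, which `hl` gives for almost
  -- every `y`.
  have h0 := ENNReal.add_right_inj hl.ne |>.1 ((add_zero _).trans he)
  have h1 := InformationTheory.klDiv_eq_zero_iff.1 h0.symm
  rw [(hopt y).2] at h1
  have := multivariateGaussian_injective (hopt y).1 (hq y).1 h1
  exact ⟨this.1.symm, this.2.symm⟩

end

end GaussianDenoising

open GaussianDenoising in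
theorem theorem3 (d : ℕ) (σ : ℝ) (hσ : 0 < σ) (pd : Measure (Space d))
    [IsProbabilityMeasure pd] (hpd : pd ≪ volume) :
    Differentiable ℝ (posteriorMean pd σ) ∧
    (∀ y, (σ ^ 2 • jacobian (posteriorMean pd σ) y).PosDef) ∧
    (∃ qopt : Kernel (Space d) (Space d),
      HasGaussianParams qopt (posteriorMean pd σ)
        (fun y => σ ^ 2 • jacobian (posteriorMean pd σ) y) ∧
      IsMinOn (jointKL pd σ) (gaussianConditionals d) qopt) ∧
    ∀ (q : Kernel (Space d) (Space d)) (m : Space d → Space d)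
      (S : Space d → Matrix (Fin d) (Fin d) ℝ),
      HasGaussianParams q m S → jointKL pd σ q ≠ ∞ →
      (IsMinOn (jointKL pd σ) (gaussianConditionals d) q ↔
        ∀ᵐ y ∂(noisedData pd σ), m y = posteriorMean pd σ y ∧
          S y = σ ^ 2 • jacobian (posteriorMean pd σ) y) := by
  have hopt := hasGaussianParams_momentMatchedKernel (pd := pd) hσ hpd
  have hmin := isMinOn_momentMatchedKernel (pd := pd) hσ hpd
  refine ⟨differentiable_posteriorMean hσ, posDef_smul_jacobian hσ hpd, ⟨_, hopt, hmin⟩,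
    fun q m S hq hfin => ⟨fun h => ?_, fun h => ?_⟩⟩
  · exact ae_eq_of_jointKL_le hσ hpd hq hfin (h ⟨_, _, hopt⟩)
  · have := hq.isMarkovKernel
    have := hopt.isMarkovKernel
    -- Changing a conditional on a null set of `y` leaves the model joint law unchanged, so
    -- almost-everywhere equality of the parameters suffices.
    have he : jointKL pd σ q = jointKL pd σ (momentMatchedKernel pd hσ hpd) := by
      refine jointKL_congr ?_
      filter_upwards [h] with y hy
      rw [(hq y).2, (hopt y).2, hy.1, hy.2]
    intro q' hq'
    change jointKL pd σ q ≤ jointKL pd σ q'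
    exact he.trans_le (hmin hq')
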